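/- Identify $\mathbb R^4$ with the quaternions $\mathbb H$. Let $\mathcal L$ be the space of lines of $\mathrm{PG}(3,\mathbb R)$ ($2$-dimensional subspaces of $\mathbb H$) and $\mathcal L^+$ the space of oriented lines, with their usual topologies. A topological spread (oriented spread) is a compact connected subset of $\mathcal L$ (of $\mathcal L^+$) such that every point of $\mathrm{PG}(3,\mathbb R)$ is incident with exactly one of its members. An ordinary (oriented) topological parallelism is a set $\Pi$ of topological spreads (oriented spreads) such that every element of $\mathcal L$ (of $\mathcal L^+$) belongs to exactly one member of $\Pi$, and such that $\Pi$ is compact in the hyperspace of compact subsets of $\mathcal L$ (of $\mathcal L^+$) with the Hausdorff topology. $\mathrm{Aut}\,\Pi$ is the group of all elements of $\mathrm{PGL}(4,\mathbb R)$ leaving $\Pi$ invariant. Let $\Lambda,\Upsilon\le \mathrm{PGL}(4,\mathbb R)$ be the groups induced by the maps $q\mapsto aq$ and $q\mapsto qb$, respectively, where $a,b\in\mathbb H$ have norm one; then $\mathrm{PSO}(4,\mathbb R)=\Lambda\times\Upsilon$ and $\Lambda\cong\Upsilon\cong\mathrm{SO}(3,\mathbb R)$. The left (right) Clifford parallelism,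 ordinary or oriented, is the set of orbits of $\Lambda$ (of $\Upsilon$) in $\mathcal L$ or in $\mathcal L^+$, respectively. The irreducible action of $\mathrm{SO}(3,\mathbb R)$ on $\mathrm{PG}(3,\mathbb R)$ is the action of $\Lambda$ or of $\Upsilon$, up to a change of coordinates $g\in\mathrm{PGL}(4,\mathbb R)$. **Theorem.** Let $\Pi$ be an ordinary or oriented topological parallelism of $\mathrm{PG}(3,\mathbb R)$ and let $g\in\mathrm{PGL}(4,\mathbb R)$. (a) If $g\Upsilon g^{-1}\le\mathrm{Aut}\,\Pi$, then either $g\Upsilon g^{-1}$ fixes every member of $\Pi$ and $\Pi$ is the image under $g$ of the (ordinary or oriented, respectively) right Clifford parallelism, or $g\Upsilon g^{-1}$ acts transitively on $\Pi$ and $\Pi$ is the image under $g$ of the left Clifford parallelism. (b) If $g\Lambda g^{-1}\le\mathrm{Aut}\,\Pi$, then either $g\Lambda g^{-1}$ fixes every member of $\Pi$ and $\Pi$ is the image under $g$ of the left Clifford parallelism, or $g\Lambda g^{-1}$ acts transitively on $\Pi$ and $\Pi$ is the image under $g$ of the right Clifford parallelism. In particular (take $g=1$), a topological parallelism admitting $\Lambda$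 or $\Upsilon$ is the left or the right Clifford parallelism. -/

import Mathlib

open scoped Quaternion Pointwise LinearAlgebra.Projectivization

noncomputable section

namespace RealParallelism

/-! ### Points, lines and oriented lines of `PG(3, ℝ)`

The 4-dimensional real vector space underlying `PG(3, ℝ)` is the quaternion algebra `ℍ[ℝ]`. -/

/-- The general linear group `GL(4, ℝ)`, acting on `ℝ⁴ = ℍ`. Nonzero scalars act trivially on lines
and (since they have positive determinant on every plane) on oriented lines, so that the actions
below are actions of `PGL(4, ℝ)`, written through representatives. -/
abbrev GL4 : Type := ℍ[ℝ] ≃ₗ[ℝ] ℍ[ℝ]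

/-- The points of `PG(3, ℝ)`. -/
abbrev Point : Type := ℙ ℝ ℍ[ℝ]

/-- The lines of `PG(3, ℝ)`: the 2-dimensional linear subspaces of `ℍ`. -/
def Line : Type := {L : Submodule ℝ ℍ[ℝ] // Module.finrank ℝ L = 2}

/-- The oriented lines of `PG(3, ℝ)`: the 2-dimensional linear subspaces of `ℍ` together with an
orientation. -/
structure OrientedLine : Type where
  line : Line
  orientation : Orientation ℝ line.1 (Fin 2)

/-- Linearly independent pairs of vectors in `ℍ`, with the subspace topology of `ℍ × ℍ`. -/
abbrev Frame : Type := {v : Fin 2 → ℍ[ℝ] // LinearIndependent ℝ v}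

/-- The line spanned by a linearly independent pair. -/
def Line.ofFrame (v : Frame) : Line :=
  ⟨Submodule.span ℝ (Set.range v.1), by rw [finrank_span_eq_card v.2]; simp⟩

/-- The line spanned by a linearly independent pair `(v₀, v₁)`, with the orientation for which
`(v₀, v₁)` is a positively oriented basis. -/
def OrientedLine.ofFrame (v : Frame) : OrientedLine :=
  ⟨Line.ofFrame v, (Module.Basis.span v.2).orientation⟩

/-- The usual (Grassmannian) topology of the line space: the quotient topology from frames. -/
instance : TopologicalSpace Line := TopologicalSpace.coinduced Line.ofFrame inferInstance

/-- The usual topology of the space of oriented lines: the quotient topology from frames. -/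
instance : TopologicalSpace OrientedLine :=
  TopologicalSpace.coinduced OrientedLine.ofFrame inferInstance

/-- Incidence of points and lines. -/
def Line.Incident (p : Point) (L : Line) : Prop := p.submodule ≤ L.1

/-- Incidence of points and oriented lines. -/
def OrientedLine.Incident (p : Point) (L : OrientedLine) : Prop := L.line.Incident p

/-! ### The action of the general linear group on lines and oriented lines -/

instance : MulAction GL4 Line where
  smul g L := ⟨L.1.map (g : ℍ[ℝ] →ₗ[ℝ] ℍ[ℝ]), by rw [LinearEquiv.finrank_map_eq]; exact L.2⟩
  one_smul L := Subtype.ext (Submodule.map_id L.1)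
  mul_smul g h L := Subtype.ext (Submodule.map_comp h.toLinearMap g.toLinearMap L.1)

theorem orientation_map_trans {M N P : Type*} [AddCommGroup M] [Module ℝ M] [AddCommGroup N]
    [Module ℝ N] [AddCommGroup P] [Module ℝ P] (e : M ≃ₗ[ℝ] N) (f : N ≃ₗ[ℝ] P)
    (o : Orientation ℝ M (Fin 2)) :
    Orientation.map (Fin 2) (e.trans f) o =
      Orientation.map (Fin 2) f (Orientation.map (Fin 2) e o) := by
  induction o using Module.Ray.ind with
  | h v hv => rfl

theorem OrientedLine.ext_map {L L' : OrientedLine} (h : L.line.1 = L'.line.1)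
    (ho : Orientation.map (Fin 2) (LinearEquiv.ofEq _ _ h) L.orientation = L'.orientation) :
    L = L' := by
  obtain ⟨⟨A, hA⟩, o⟩ := L
  obtain ⟨⟨B, hB⟩, o'⟩ := L'
  obtain rfl : A = B := h
  have : (LinearEquiv.ofEq A A rfl) = LinearEquiv.refl ℝ A := rfl
  simp only [this, Orientation.map_refl, Equiv.refl_apply] at ho
  rw [ho]

/-- A linear bijection maps an oriented line to its image, carrying the orientation along. -/
instance : MulAction GL4 OrientedLine where
  smul g L := ⟨g • L.line, Orientation.map (Fin 2) (g.submoduleMap L.line.1) L.orientation⟩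
  one_smul L := by
    refine OrientedLine.ext_map (Submodule.map_id L.line.1) ?_
    change Orientation.map (Fin 2) _ (Orientation.map (Fin 2) _ L.orientation) = _
    rw [← orientation_map_trans]
    exact DFunLike.congr_fun (Orientation.map_refl (Fin 2)) L.orientation
  mul_smul g h L := by
    refine OrientedLine.ext_map (Submodule.map_comp h.toLinearMap g.toLinearMap L.line.1) ?_
    change Orientation.map (Fin 2) _ (Orientation.map (Fin 2) _ L.orientation) =
      Orientation.map (Fin 2) _ (Orientation.map (Fin 2) _ L.orientation)
    rw [← orientation_map_trans, ← orientation_map_trans]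
    rfl

/-! ### Topological spreads and parallelisms

`X` stands for the space of lines or of oriented lines. -/

section Parallelism

variable {X : Type} [TopologicalSpace X]

/-- A topological (oriented) spread: a compact connected set of (oriented) lines such that each
point is incident with exactly one member. -/
def IsTopologicalSpread (Inc : Point → X → Prop) (C : Set X) : Prop :=
  IsCompact C ∧ IsConnected C ∧ ∀ p : Point, ∃! L : X, L ∈ C ∧ Inc p L

/-- A topological (oriented) parallelism: a set of topological (oriented) spreads such that every
(oriented) line belongs to exactly one of them, and which is compact in the hyperspace of compact
subsets of `X`. The topology of `Compacts X` is the Vietoris topology, that is, the one of the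
Hausdorff distance for any metric inducing the topology of `X`. -/
def IsTopologicalParallelism (Inc : Point → X → Prop) (P : Set (Set X)) : Prop :=
  (∀ C ∈ P, IsTopologicalSpread Inc C) ∧
  (∀ L : X, ∃! C : Set X, C ∈ P ∧ L ∈ C) ∧
  IsCompact {K : TopologicalSpace.Compacts X | (K : Set X) ∈ P}

end Parallelism

/-- Ordinary topological parallelisms of `PG(3, ℝ)`. -/
def IsOrdinaryParallelism (P : Set (Set Line)) : Prop :=
  IsTopologicalParallelism Line.Incident P

/-- Oriented topological parallelisms of `PG(3, ℝ)`. -/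
def IsOrientedParallelism (P : Set (Set OrientedLine)) : Prop :=
  IsTopologicalParallelism OrientedLine.Incident P

section Groups

variable {X : Type} [MulAction GL4 X]

/-- The automorphism group of a set `P` of sets of (oriented) lines (more precisely, its full
preimage in `GL(4, ℝ)`): all `g` with `g • P = P`, where `g • P = {g • C | C ∈ P}`. -/
def aut (P : Set (Set X)) : Subgroup GL4 := MulAction.stabilizer GL4 P

/-- The group `H` fixes every member of `P`. -/
def FixesClasses (H : Subgroup GL4) (P : Set (Set X)) : Prop :=
  ∀ h ∈ H, ∀ C ∈ P, h • C = C

/-- The group `H` is transitive on `P`. -/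
def TransitiveOnClasses (H : Subgroup GL4) (P : Set (Set X)) : Prop :=
  ∀ C ∈ P, ∀ D ∈ P, ∃ h ∈ H, h • C = D

end Groups

/-! ### The two factors of `PSO(4, ℝ)` and the Clifford parallelisms -/

/-- The group of all maps `q ↦ a * q` with `a` a quaternion of norm one. Its image in `PGL(4, ℝ)`
is the factor `Λ` of `PSO(4, ℝ)`. -/
def leftFactor : Subgroup GL4 where
  carrier := {g | ∃ a : ℍ[ℝ], ‖a‖ = 1 ∧ ∀ q, g q = a * q}
  one_mem' := ⟨1, norm_one, fun q => (one_mul q).symm⟩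
  mul_mem' := by
    rintro g h ⟨a, ha, hg⟩ ⟨b, hb, hh⟩
    exact ⟨a * b, by rw [norm_mul, ha, hb, one_mul], fun q => by
      rw [LinearEquiv.mul_apply, hh, hg, mul_assoc]⟩
  inv_mem' := by
    rintro g ⟨a, ha, hg⟩
    have h0 : a ≠ 0 := fun h => by simp [h] at ha
    refine ⟨a⁻¹, by rw [norm_inv, ha, inv_one], fun q => ?_⟩
    change g.symm q = _
    rw [LinearEquiv.symm_apply_eq, hg, mul_inv_cancel_left₀ h0]

/-- The group of all maps `q ↦ q * b` with `b` a quaternion of norm one. Its image in `PGL(4, ℝ)`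
is the factor `Υ` of `PSO(4, ℝ)`. -/
def rightFactor : Subgroup GL4 where
  carrier := {g | ∃ b : ℍ[ℝ], ‖b‖ = 1 ∧ ∀ q, g q = q * b}
  one_mem' := ⟨1, norm_one, fun q => (mul_one q).symm⟩
  mul_mem' := by
    rintro g h ⟨a, ha, hg⟩ ⟨b, hb, hh⟩
    exact ⟨b * a, by rw [norm_mul, ha, hb, one_mul], fun q => by
      rw [LinearEquiv.mul_apply, hh, hg, mul_assoc]⟩
  inv_mem' := by
    rintro g ⟨a, ha, hg⟩
    have h0 : a ≠ 0 := fun h => by simp [h] at ha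
    refine ⟨a⁻¹, by rw [norm_inv, ha, inv_one], fun q => ?_⟩
    change g.symm q = _
    rw [LinearEquiv.symm_apply_eq, hg, inv_mul_cancel_right₀ h0]

/-- The left Clifford parallelism (ordinary for `X = Line`, oriented for `X = OrientedLine`): the
set of orbits of the left factor. -/
def leftClifford (X : Type) [MulAction GL4 X] : Set (Set X) :=
  Set.range fun L : X => MulAction.orbit leftFactor L

/-- The right Clifford parallelism (ordinary for `X = Line`, oriented for `X = OrientedLine`): the
set of orbits of the right factor. -/
def rightClifford (X : Type) [MulAction GL4 X] : Set (Set X) :=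
  Set.range fun L : X => MulAction.orbit rightFactor L

end RealParallelism

end

open RealParallelism

noncomputable section

namespace RealParallelism

/-! ### Imaginary units of the quaternions -/

/-! Every (oriented) line through `q ≠ 0` is spanned by a frame `(q, q b)` with `b * b = -1`; the
unit `b` is unique for oriented lines and unique up to sign for ordinary ones. Left multiplication
keeps `b`, while right multiplication by `r` replaces it by `r⁻¹ b r`. So the left Clifford classes
are the sets of lines with a fixed unit, and the right multiplications commuting with `b` fix every
line with unit `b`.

Let the right factor act on the parallelism. A class containing a line with unit `b` is then
invariant under the centralizer of `b`, because the class of a fixed line is unique. If a class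
contains lines with two non-commuting units, the two centralizers generate all unit quaternions
(`eq_top_of_centralizers_le`). The class is thus invariant under the whole right factor, which is
transitive on points, so it is a right orbit. Otherwise only `b` and `-b` occur, and connectedness
excludes a change of orientation, so the class is a left orbit (`IsLineModel.class_eq_orbit`).

The two kinds of classes cannot coexist: all imaginary units are conjugate, so every right orbit
meets every left orbit. The same fact gives transitivity in the left case. Transport by `g` and
quaternion conjugation, which exchanges the two factors, yield the remaining statements. Lines and
oriented lines are treated together through `IsLineModel`. -/

theorem re_eq_zero_of_mul_self {b : ℍ[ℝ]} (hb : b * b = -1) : b.re = 0 := by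
  have h0 := congrArg QuaternionAlgebra.re hb
  have h1 := congrArg QuaternionAlgebra.imI hb
  have h2 := congrArg QuaternionAlgebra.imJ hb
  have h3 := congrArg QuaternionAlgebra.imK hb
  simp at h0 h1 h2 h3
  by_contra h
  have e1 : b.imI = 0 := by
    have : b.re * b.imI = 0 := by linarith
    simpa [h] using this
  have e2 : b.imJ = 0 := by
    have : b.re * b.imJ = 0 := by linarith
    simpa [h] using this
  have e3 : b.imK = 0 := by
    have : b.re * b.imK = 0 := by linarith
    simpa [h] using this
  rw [e1, e2, e3] at h0
  nlinarith [mul_self_nonneg b.re]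

theorem norm_eq_one_of_mul_self {b : ℍ[ℝ]} (hb : b * b = -1) : ‖b‖ = 1 := by
  have h : ‖b‖ * ‖b‖ = 1 := by rw [← norm_mul, hb, norm_neg, norm_one]
  nlinarith [norm_nonneg b]

theorem ne_zero_of_mul_self {b : ℍ[ℝ]} (hb : b * b = -1) : b ≠ 0 := by
  rintro rfl
  simp at hb

theorem mul_self_of_re_eq_zero {x : ℍ[ℝ]} (hx : x.re = 0) :
    x * x = ((-(‖x‖ ^ 2) : ℝ) : ℍ[ℝ]) := by
  have hs : star x = -x := by ext <;> simp [hx]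
  have h := Quaternion.self_mul_star x
  rw [hs, mul_neg, Quaternion.normSq_eq_norm_mul_self] at h
  rw [neg_eq_iff_eq_neg] at h
  rw [h]
  push_cast
  rw [pow_two]

theorem conj_mul_self {b r : ℍ[ℝ]} (hb : b * b = -1) (hr : r ≠ 0) :
    (r⁻¹ * b * r) * (r⁻¹ * b * r) = -1 := by
  have : (r⁻¹ * b * r) * (r⁻¹ * b * r) = r⁻¹ * (b * (r * r⁻¹) * b) * r := by noncomm_ring
  rw [this, mul_inv_cancel₀ hr, mul_one, hb]
  simp [hr]

/-- For commuting elements `c² - b²` factors, and the quaternions have no zero divisors. -/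
theorem eq_or_eq_neg_of_commute {b c : ℍ[ℝ]} (hb : b * b = -1) (hc : c * c = -1)
    (h : Commute b c) : c = b ∨ c = -b := by
  have h0 : (c - b) * (c + b) = 0 := by
    have : (c - b) * (c + b) = c * c - b * b + (c * b - b * c) := by noncomm_ring
    rw [this, hb, hc, h.eq]
    simp
  rcases mul_eq_zero.1 h0 with h1 | h1
  · exact Or.inl (sub_eq_zero.1 h1)
  · exact Or.inr (eq_neg_of_add_eq_zero_left h1)

theorem quaternion_two_ne_zero : (2 : ℍ[ℝ]) ≠ 0 := by
  have h : (2 : ℍ[ℝ]) = ((2 : ℝ) : ℍ[ℝ]) := by norm_cast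
  rw [h]
  exact fun h0 => two_ne_zero (Quaternion.coe_injective (h0.trans Quaternion.coe_zero.symm))

/-- The anticommutator of pure quaternions is `-2` times their inner product; this turns
orthogonality into an algebraic identity. -/
theorem mul_add_mul_swap {b b' : ℍ[ℝ]} (hb : b.re = 0) (hb' : b'.re = 0) :
    b * b' + b' * b = ((2 * (b * b').re : ℝ) : ℍ[ℝ]) := by
  ext <;> simp [hb, hb'] <;> ring

/-- The centralizer of an imaginary unit `b` is `ℝ + ℝ b`. -/
theorem exists_eq_add_of_commute {b c : ℍ[ℝ]} (hb : b * b = -1) (h : Commute c b) :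
    ∃ s t : ℝ, c = s • (1 : ℍ[ℝ]) + t • b := by
  have h1 := mul_add_mul_swap (b := c - (c.re : ℍ[ℝ])) (b' := b) (by simp)
    (re_eq_zero_of_mul_self hb)
  set c' := c - (c.re : ℍ[ℝ]) with hc'
  have hcomm : b * c' = c' * b := by
    rw [hc', mul_sub, sub_mul, h.eq, Quaternion.coe_commutes]
  rw [hcomm] at h1
  refine ⟨c.re, -(c' * b).re, ?_⟩
  have h2 : c' * b = (((c' * b).re : ℝ) : ℍ[ℝ]) := by
    have : (2 : ℍ[ℝ]) * (c' * b) = 2 * (((c' * b).re : ℝ) : ℍ[ℝ]) := by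
      rw [two_mul, h1]; push_cast; rfl
    exact mul_left_cancel₀ quaternion_two_ne_zero this
  have h3 : c' = -(c' * b * b) := by rw [mul_assoc, hb]; simp
  have h4 : c = (c.re : ℍ[ℝ]) + c' := by rw [hc']; abel
  conv_lhs => rw [h4, h3, h2]
  rw [neg_smul, ← Quaternion.coe_mul_eq_smul, ← Quaternion.coe_mul_eq_smul, mul_one]

/-- Every quaternion is `s + t b` with `b` an imaginary unit; if it is not real, then `t > 0`
can be achieved. -/
theorem exists_eq_add_imaginaryUnit {x : ℍ[ℝ]} (hx : ∀ s : ℝ, x ≠ s) :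
    ∃ b : ℍ[ℝ], b * b = -1 ∧ ∃ s t : ℝ, 0 < t ∧ x = s • (1 : ℍ[ℝ]) + t • b := by
  set y := x - (x.re : ℍ[ℝ]) with hy
  have hy0 : y ≠ 0 := fun h => hx x.re (sub_eq_zero.1 h)
  have hn : 0 < ‖y‖ := norm_pos_iff.2 hy0
  have hyy := mul_self_of_re_eq_zero (x := y) (by simp [hy])
  refine ⟨(‖y‖⁻¹ : ℝ) • y, ?_, x.re, ‖y‖, hn, ?_⟩
  · rw [smul_mul_smul_comm, hyy, ← Quaternion.coe_mul_eq_smul, ← Quaternion.coe_mul]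
    have : ‖y‖⁻¹ * ‖y‖⁻¹ * -(‖y‖ ^ 2) = -1 := by field_simp
    rw [this]; simp
  · rw [smul_smul, mul_inv_cancel₀ hn.ne', one_smul, ← Quaternion.coe_mul_eq_smul, mul_one, hy]
    abel

/-! ### Rotations about an axis -/

theorem exists_normalized {u : ℍ[ℝ]} (hu : u ≠ 0) : ‖(‖u‖⁻¹ : ℝ) • u‖ = 1 := by
  rw [norm_smul, norm_inv, norm_norm, inv_mul_cancel₀ (norm_ne_zero_iff.2 hu)]

/-- The rotations about the axis `b` act transitively on the circles of latitude. -/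
theorem exists_commute_of_re_eq {b x y : ℍ[ℝ]} (hb : b * b = -1) (hx : x * x = -1)
    (hy : y * y = -1) (h : (b * x).re = (b * y).re) :
    ∃ u : ℍ[ℝ], u ≠ 0 ∧ Commute u b ∧ u * x = y * u := by
  have hb0 := re_eq_zero_of_mul_self hb
  have ax := mul_add_mul_swap hb0 (re_eq_zero_of_mul_self hx)
  have ay := mul_add_mul_swap hb0 (re_eq_zero_of_mul_self hy)
  rw [← h] at ay
  obtain ⟨m, hm⟩ : ∃ m, m = (b * x).re := ⟨_, rfl⟩
  rw [← hm] at ax ay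
  clear hm h
  -- components orthogonal to `b`
  obtain ⟨x', rfl⟩ : ∃ x', x = x' - (m : ℍ[ℝ]) * b := ⟨x + m * b, by abel⟩
  obtain ⟨y', rfl⟩ : ∃ y', y = y' - (m : ℍ[ℝ]) * b := ⟨y + m * b, by abel⟩
  have cm : ∀ z : ℍ[ℝ], z * (m : ℍ[ℝ]) = (m : ℍ[ℝ]) * z := fun z =>
    (Quaternion.coe_commutes m z).symm
  have bx : b * x' = -(x' * b) := by
    have : b * x' + x' * b = (b * (x' - m * b) + (x' - m * b) * b) + 2 * m * (b * b) := by
      rw [mul_sub, sub_mul, ← mul_assoc b, cm b]; noncomm_ring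
    rw [ax, hb] at this
    rw [eq_neg_iff_add_eq_zero, this, mul_neg_one, ← sub_eq_add_neg,
      sub_eq_zero, two_mul, two_mul, Quaternion.coe_add]
  have by' : b * y' = -(y' * b) := by
    have : b * y' + y' * b = (b * (y' - m * b) + (y' - m * b) * b) + 2 * m * (b * b) := by
      rw [mul_sub, sub_mul, ← mul_assoc b, cm b]; noncomm_ring
    rw [ay, hb] at this
    rw [eq_neg_iff_add_eq_zero, this, mul_neg_one, ← sub_eq_add_neg,
      sub_eq_zero, two_mul, two_mul, Quaternion.coe_add]
  have sq : ∀ z : ℍ[ℝ], b * z = -(z * b) → (z - m * b) * (z - m * b) = z * z - m * m := by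
    intro z hz
    have e1 : (z - m * b) * (z - m * b) =
      z * z - (z * m) * b - m * (b * z) + m * (b * m) * b := by noncomm_ring
    rw [e1, cm z, cm b, hz]
    have e2 : (m : ℍ[ℝ]) * (m * b) * b = m * m * (b * b) := by noncomm_ring
    rw [e2, hb]; noncomm_ring
  obtain ⟨n, hn⟩ : ∃ n : ℝ, ((n : ℝ) : ℍ[ℝ]) = 1 - m * m := ⟨1 - m * m, by push_cast; rfl⟩
  have xx : x' * x' = -(n : ℍ[ℝ]) := by
    rw [sq x' bx] at hx; rw [hn, ← sub_eq_zero]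
    rw [← sub_eq_zero] at hx; rw [← hx]; abel
  have yy : y' * y' = -(n : ℍ[ℝ]) := by
    rw [sq y' by'] at hy; rw [hn, ← sub_eq_zero]
    rw [← sub_eq_zero] at hy; rw [← hy]; abel
  have cn : ∀ z : ℍ[ℝ], z * (n : ℍ[ℝ]) = (n : ℍ[ℝ]) * z := fun z =>
    (Quaternion.coe_commutes n z).symm
  have key : ∀ u : ℍ[ℝ], Commute u b → u * x' = y' * u →
      u * (x' - m * b) = (y' - m * b) * u := by
    intro u hub hu
    rw [mul_sub, sub_mul, hu, ← mul_assoc, cm u, mul_assoc, hub.eq, mul_assoc]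
  by_cases hxy : y' = -x'
  · refine ⟨b, ne_zero_of_mul_self hb, Commute.refl b, key b (Commute.refl b) ?_⟩
    rw [hxy, bx, neg_mul]
  -- Since `x'² = y'² = -n`, the element `u = n - y' x'` satisfies `u x' = n (x' + y') = y' u`. It
  -- commutes with `b` because `x'` and `y'` anticommute with `b`, and it can vanish only if `y' =
  -- -x'`.
  · have hu0 : (n : ℍ[ℝ]) - y' * x' ≠ 0 := by
      intro h0
      have h1 : y' * (y' + x') = 0 := by
        rw [mul_add, yy, ← sub_eq_zero.1 h0]; abel
      have h2 : (y' + x') * x' = 0 := by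
        rw [add_mul, xx, ← sub_eq_zero.1 h0]; abel
      have h3 : y' + x' ≠ 0 := fun h => hxy (eq_neg_of_add_eq_zero_left h)
      have h4 : y' = 0 := (mul_eq_zero.1 h1).resolve_right h3
      have h5 : x' = 0 := (mul_eq_zero.1 h2).resolve_left h3
      exact h3 (by rw [h4, h5, add_zero])
    have hub : Commute ((n : ℍ[ℝ]) - y' * x') b := by
      refine Commute.sub_left (Quaternion.coe_commutes n b) ?_
      change y' * x' * b = b * (y' * x')
      rw [← mul_assoc, by', neg_mul, mul_assoc, mul_assoc y' b, bx]; simp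
    refine ⟨_, hu0, hub, key _ hub ?_⟩
    rw [sub_mul, mul_sub, mul_assoc, xx, ← mul_assoc y' y', yy, cn y']
    rw [mul_neg, cn y', neg_mul]
    abel

/-- All imaginary units are conjugate. -/
theorem exists_conj_eq {b c : ℍ[ℝ]} (hb : b * b = -1) (hc : c * c = -1) :
    ∃ r : ℍ[ℝ], ‖r‖ = 1 ∧ r⁻¹ * b * r = c := by
  have key : ∃ r : ℍ[ℝ], r ≠ 0 ∧ b * r = r * c := by
    by_cases h : c = -b
    · -- a quaternion anticommuting with `b`
      subst h
      have h1 : ∃ z : ℍ[ℝ], ¬ Commute b z := by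
        by_contra hall
        push Not at hall
        obtain ⟨i, i0, i1, i2, i3⟩ : ∃ i : ℍ[ℝ], i.re = 0 ∧ i.imI = 1 ∧ i.imJ = 0 ∧ i.imK = 0 :=
          ⟨⟨0, 1, 0, 0⟩, rfl, rfl, rfl, rfl⟩
        obtain ⟨j, j0, j1, j2, j3⟩ : ∃ j : ℍ[ℝ], j.re = 0 ∧ j.imI = 0 ∧ j.imJ = 1 ∧ j.imK = 0 :=
          ⟨⟨0, 0, 1, 0⟩, rfl, rfl, rfl, rfl⟩
        have hI := (hall i).eq
        have hJ := (hall j).eq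
        apply ne_zero_of_mul_self hb
        have hre := re_eq_zero_of_mul_self hb
        rw [Quaternion.ext_iff] at hI hJ
        simp [*] at hI hJ
        ext <;> simp <;> linarith
      obtain ⟨z, hz⟩ := h1
      refine ⟨b * z - z * b, fun h0 => hz (sub_eq_zero.1 h0), ?_⟩
      have : b * (b * z - z * b) - (b * z - z * b) * -b = (b * b) * z - z * (b * b) := by
        noncomm_ring
      rw [← sub_eq_zero, this, hb]; noncomm_ring
    -- Both `b (b + c)` and `(b + c) c` equal `b c - 1`.
    · refine ⟨b + c, fun h0 => h (eq_neg_of_add_eq_zero_right h0), ?_⟩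
      rw [mul_add, add_mul, hb, hc, add_comm]
  obtain ⟨r, hr, h⟩ := key
  refine ⟨(‖r‖⁻¹ : ℝ) • r, exists_normalized hr, ?_⟩
  have hn : (‖r‖⁻¹ : ℝ) • r ≠ 0 := by simp [hr]
  rw [mul_assoc, inv_mul_eq_iff_eq_mul₀ hn, mul_smul_comm, h, smul_mul_assoc]

/-! ### Generation of the group of unit quaternions -/

theorem re_lt_one_of_norm {x : ℍ[ℝ]} (hx : ‖x‖ = 1) (h : x ≠ 1) : x.re < 1 := by
  have h1 := Quaternion.normSq_eq_norm_mul_self x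
  rw [hx, Quaternion.normSq_def'] at h1
  by_contra hlt
  push Not at hlt
  have a1 : x.imI ^ 2 + x.imJ ^ 2 + x.imK ^ 2 ≤ 0 := by nlinarith
  have a2 : x.re = 1 := by nlinarith [sq_nonneg x.imI, sq_nonneg x.imJ, sq_nonneg x.imK]
  apply h
  have i1 : x.imI = 0 := by nlinarith [sq_nonneg x.imI, sq_nonneg x.imJ, sq_nonneg x.imK]
  have i2 : x.imJ = 0 := by nlinarith [sq_nonneg x.imI, sq_nonneg x.imJ, sq_nonneg x.imK]
  have i3 : x.imK = 0 := by nlinarith [sq_nonneg x.imI, sq_nonneg x.imJ, sq_nonneg x.imK]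
  ext <;> simp [*]

theorem norm_circle {b : ℍ[ℝ]} (hb : b * b = -1) (t : ℝ) :
    ‖Real.cos t • (1 : ℍ[ℝ]) + Real.sin t • b‖ = 1 := by
  have hn := norm_eq_one_of_mul_self hb
  have h1 := Quaternion.normSq_eq_norm_mul_self b
  have h2 := Quaternion.normSq_eq_norm_mul_self (Real.cos t • (1 : ℍ[ℝ]) + Real.sin t • b)
  have hre := re_eq_zero_of_mul_self hb
  rw [hn, Quaternion.normSq_def', hre] at h1
  rw [Quaternion.normSq_def'] at h2
  simp [hre] at h2
  have h3 : ‖Real.cos t • (1 : ℍ[ℝ]) + Real.sin t • b‖ *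
      ‖Real.cos t • (1 : ℍ[ℝ]) + Real.sin t • b‖ = 1 := by
    rw [← h2]
    nlinarith [Real.sin_sq_add_cos_sq t]
  nlinarith [norm_nonneg (Real.cos t • (1 : ℍ[ℝ]) + Real.sin t • b)]

/-- The unit quaternions are generated by the centralizers of two imaginary units that do not
commute. -/
theorem eq_top_of_centralizers_le {b c : ℍ[ℝ]} (hb : b * b = -1) (hc : c * c = -1)
    (hbc : ¬ Commute b c) (K : Subgroup (Metric.sphere (0 : ℍ[ℝ]) 1))
    (hKb : ∀ r : Metric.sphere (0 : ℍ[ℝ]) 1, Commute (r : ℍ[ℝ]) b → r ∈ K)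
    (hKc : ∀ r : Metric.sphere (0 : ℍ[ℝ]) 1, Commute (r : ℍ[ℝ]) c → r ∈ K) : K = ⊤ := by
  have hne : ∀ r : Metric.sphere (0 : ℍ[ℝ]) 1, (r : ℍ[ℝ]) ≠ 0 := fun r =>
    ne_zero_of_mem_unit_sphere r
  -- `f r` is the inner product of `b` with `r⁻¹ b r`, that is, the latitude of the conjugate with
  -- respect to the pole `b`.
  let f : ℍ[ℝ] → ℝ := fun r => -(b * (r⁻¹ * b * r)).re
  have hre : Continuous (fun x : ℍ[ℝ] => x.re) := Quaternion.continuous_re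
  -- An arc in the centralizer of `c`, leading from `1` at `t = 0` to `c` at `t = π / 2`.
  let e : ℝ → Metric.sphere (0 : ℍ[ℝ]) 1 := fun t =>
    ⟨Real.cos t • (1 : ℍ[ℝ]) + Real.sin t • c, by simpa using norm_circle hc t⟩
  have hfc : Continuous fun r : Metric.sphere (0 : ℍ[ℝ]) 1 => f r := by
    have : Continuous fun r : Metric.sphere (0 : ℍ[ℝ]) 1 => ((r : ℍ[ℝ]))⁻¹ :=
      continuous_subtype_val.inv₀ hne
    exact (hre.comp (continuous_const.mul
      ((this.mul continuous_const).mul continuous_subtype_val))).neg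
  have hec : Continuous e := by
    refine Continuous.subtype_mk ?_ _
    fun_prop
  have f1 : f (1 : Metric.sphere (0 : ℍ[ℝ]) 1) = 1 := by
    simp only [f, Metric.unitSphere.coe_one, inv_one, one_mul, mul_one, hb,
      Quaternion.re_neg, Quaternion.re_one, neg_neg]
  have he0 : e 0 = 1 := Subtype.ext (by simp [e])
  have heK : ∀ t, e t ∈ K := fun t => hKc _ (by
    refine Commute.add_left ?_ ?_
    · exact (Commute.one_left c).smul_left _
    · exact (Commute.refl c).smul_left _)
  have hfe : f (e (Real.pi / 2)) < 1 := by
    have : ((e (Real.pi / 2) : Metric.sphere (0 : ℍ[ℝ]) 1) : ℍ[ℝ]) = c := by simp [e]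
    have h1 := re_lt_one_of_norm (x := -(b * (c⁻¹ * b * c)))
      (by rw [norm_neg, norm_mul, norm_mul, norm_mul, norm_inv, norm_eq_one_of_mul_self hb,
            norm_eq_one_of_mul_self hc]; norm_num)
      (by
        intro h
        apply hbc
        have h2 : b * (c⁻¹ * b * c) = b * b := by rw [hb, ← h, neg_neg]
        have h3 := mul_left_cancel₀ (ne_zero_of_mul_self hb) h2
        rw [mul_assoc, inv_mul_eq_iff_eq_mul₀ (ne_zero_of_mul_self hc)] at h3
        exact h3)
    simpa [f, this] using h1
  -- By the intermediate value theorem some `e t` gives the same latitude as `r`. A rotation `v`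
  -- about `b` matches the two conjugates of `b`, so `e t * v * r⁻¹` centralizes `b`. Hence `K`
  -- contains a neighbourhood of `1`.
  have hmem : ∀ r : Metric.sphere (0 : ℍ[ℝ]) 1, f (e (Real.pi / 2)) < f r → r ∈ K := by
    intro r hr
    have hr1 : f r ≤ 1 := by
      by_cases h : -(b * ((r : ℍ[ℝ])⁻¹ * b * r)) = 1
      · have := congrArg QuaternionAlgebra.re h
        simp only [f]
        simpa using this.le
      · refine le_of_lt ?_
        have := re_lt_one_of_norm (x := -(b * ((r : ℍ[ℝ])⁻¹ * b * r)))
          (by simp [norm_eq_one_of_mul_self hb]) h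
        simpa [f] using this
    obtain ⟨t, -, ht⟩ : f r ∈ (fun t => f (e t)) '' Set.Icc 0 (Real.pi / 2) := by
      refine intermediate_value_Icc' (by positivity) (hfc.comp hec).continuousOn ⟨hr.le, ?_⟩
      change f r ≤ f (e 0)
      rw [he0, f1]
      exact hr1
    obtain ⟨u, hu0, hub, hu⟩ := exists_commute_of_re_eq hb (conj_mul_self hb (hne r))
      (conj_mul_self hb (hne (e t))) (neg_injective ht.symm)
    let v : Metric.sphere (0 : ℍ[ℝ]) 1 := ⟨(‖u‖⁻¹ : ℝ) • u, by
      rw [mem_sphere_zero_iff_norm]; exact exists_normalized hu0⟩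
    have hvb : Commute (v : ℍ[ℝ]) b := hub.smul_left _
    have hv : (v : ℍ[ℝ]) * ((r : ℍ[ℝ])⁻¹ * b * r) = (((e t : ℍ[ℝ]))⁻¹ * b * (e t)) * v := by
      simp only [v, smul_mul_assoc, mul_smul_comm, hu]
    have hw : e t * v * r⁻¹ ∈ K := by
      apply hKb
      change ((e t : ℍ[ℝ]) * v * (r : ℍ[ℝ])⁻¹) * b = b * ((e t : ℍ[ℝ]) * v * (r : ℍ[ℝ])⁻¹)
      have h1 : ((e t : ℍ[ℝ]) * v * (r : ℍ[ℝ])⁻¹) * b =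
          (e t : ℍ[ℝ]) * (v * ((r : ℍ[ℝ])⁻¹ * b * r)) * (r : ℍ[ℝ])⁻¹ := by
        simp only [mul_assoc, mul_inv_cancel₀ (hne r), mul_one]
      rw [h1, hv]
      simp only [mul_assoc, mul_inv_cancel_left₀ (hne (e t))]
    have : r = (e t * v * r⁻¹)⁻¹ * (e t * v) := by group
    rw [this]
    exact K.mul_mem (K.inv_mem hw) (K.mul_mem (heK t) (hKb v hvb))
  have hopen : IsOpen (K : Set (Metric.sphere (0 : ℍ[ℝ]) 1)) := by
    refine Subgroup.isOpen_of_mem_nhds K (g := 1) ?_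
    have : {r : Metric.sphere (0 : ℍ[ℝ]) 1 | f (e (Real.pi / 2)) < f r} ∈ nhds 1 :=
      (isOpen_lt continuous_const hfc).mem_nhds (by
        rw [Set.mem_ofPred_eq, f1]; exact hfe)
    exact Filter.mem_of_superset this hmem
  have : PreconnectedSpace (Metric.sphere (0 : ℍ[ℝ]) 1) := by
    refine Subtype.preconnectedSpace (isPreconnected_sphere ?_ 0 1)
    rw [← Module.finrank_eq_rank, Quaternion.finrank_eq_four]
    norm_num
  have := IsClopen.eq_univ (s := (K : Set (Metric.sphere (0 : ℍ[ℝ]) 1)))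
    ⟨Subgroup.isClosed_of_isOpen K hopen, hopen⟩ ⟨1, K.one_mem⟩
  exact SetLike.coe_injective (by rw [this]; rfl)
/-! ### Frames adapted to an imaginary unit -/

theorem linearIndependent_mul_imaginaryUnit {q b : ℍ[ℝ]} (hq : q ≠ 0) (hb : b * b = -1) :
    LinearIndependent ℝ ![q, q * b] := by
  rw [LinearIndependent.pair_iff]
  intro s t h
  have h1 : q * (s • (1 : ℍ[ℝ]) + t • b) = 0 := by
    rw [← h, mul_add, mul_smul_comm, mul_smul_comm, mul_one]
  have h2 := (mul_eq_zero.1 h1).resolve_left hq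
  have hs : s = 0 := by
    have := congrArg QuaternionAlgebra.re h2
    simpa [re_eq_zero_of_mul_self hb] using this
  subst hs
  rw [zero_smul, zero_add] at h2
  exact ⟨rfl, (smul_eq_zero.1 h2).resolve_right (ne_zero_of_mul_self hb)⟩

/-- The frame `(q, q b)`, for an imaginary unit `b`. -/
def frame (q b : ℍ[ℝ]) (hq : q ≠ 0) (hb : b * b = -1) : Frame :=
  ⟨![q, q * b], linearIndependent_mul_imaginaryUnit hq hb⟩

/-- The image of a frame under a linear bijection. -/
def Frame.map (g : GL4) (v : Frame) : Frame :=
  ⟨g ∘ v.1, v.2.map' g.toLinearMap g.ker⟩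

/-- Because `q b r = (q r)(r⁻¹ b r)`, right multiplication conjugates the unit of a frame. -/
theorem map_frame_right {h : GL4} {r q b : ℍ[ℝ]} (hr : r ≠ 0) (hh : ∀ x, h x = x * r)
    (hq : q ≠ 0) (hb : b * b = -1) :
    Frame.map h (frame q b hq hb) =
      frame (q * r) (r⁻¹ * b * r) (mul_ne_zero hq hr) (conj_mul_self hb hr) := by
  apply Subtype.ext
  funext i
  fin_cases i
  · exact hh q
  · change h (q * b) = q * r * (r⁻¹ * b * r)
    rw [hh]
    simp only [mul_assoc, mul_inv_cancel_left₀ hr]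

theorem map_frame_left {h : GL4} {a q b : ℍ[ℝ]} (ha : a ≠ 0) (hh : ∀ x, h x = a * x)
    (hq : q ≠ 0) (hb : b * b = -1) :
    Frame.map h (frame q b hq hb) = frame (a * q) b (mul_ne_zero ha hq) hb := by
  apply Subtype.ext
  funext i
  fin_cases i
  · exact hh q
  · change h (q * b) = a * q * b
    rw [hh, mul_assoc]

/-- Right multiplication by the inverse of a unit quaternion, as a linear action. -/
def rightHom : Metric.sphere (0 : ℍ[ℝ]) 1 →* GL4 where
  toFun r :=
    { toFun := fun q => q * (r : ℍ[ℝ])⁻¹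
      invFun := fun q => q * (r : ℍ[ℝ])
      map_add' := fun x y => add_mul x y _
      map_smul' := fun s x => smul_mul_assoc s x _
      left_inv := fun x => inv_mul_cancel_right₀ (ne_zero_of_mem_unit_sphere r) x
      right_inv := fun x => mul_inv_cancel_right₀ (ne_zero_of_mem_unit_sphere r) x }
  map_one' := LinearEquiv.ext fun x => by
    change x * ((1 : Metric.sphere (0 : ℍ[ℝ]) 1) : ℍ[ℝ])⁻¹ = x
    simp
  map_mul' r s := LinearEquiv.ext fun x => by
    change x * ((r * s : Metric.sphere (0 : ℍ[ℝ]) 1) : ℍ[ℝ])⁻¹ = x * (s : ℍ[ℝ])⁻¹ * (r : ℍ[ℝ])⁻¹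
    rw [Metric.unitSphere.coe_mul, mul_inv_rev, mul_assoc]

theorem rightHom_apply (r : Metric.sphere (0 : ℍ[ℝ]) 1) (q : ℍ[ℝ]) :
    rightHom r q = q * (r : ℍ[ℝ])⁻¹ := rfl

theorem rightHom_mem (r : Metric.sphere (0 : ℍ[ℝ]) 1) : rightHom r ∈ rightFactor :=
  ⟨(r : ℍ[ℝ])⁻¹, by rw [norm_inv, norm_eq_of_mem_sphere, inv_one], rightHom_apply r⟩

theorem exists_mem_rightFactor {r : ℍ[ℝ]} (hr : ‖r‖ = 1) :
    ∃ h ∈ rightFactor, ∀ q, h q = q * r := by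
  refine ⟨rightHom ⟨r, by simpa using hr⟩⁻¹, rightHom_mem _, fun q => ?_⟩
  rw [rightHom_apply]
  simp

/-- Conjugation of quaternions as a linear bijection. -/
def starEquiv : GL4 where
  toFun := star
  invFun := star
  map_add' := star_add
  map_smul' := Quaternion.star_smul
  left_inv := star_star
  right_inv := star_star

theorem starEquiv_apply (q : ℍ[ℝ]) : starEquiv q = star q := rfl

theorem starEquiv_inv : (starEquiv)⁻¹ = starEquiv := by
  rw [inv_eq_iff_mul_eq_one]
  exact LinearEquiv.ext fun q => star_star q

theorem exists_mem_leftFactor {a : ℍ[ℝ]} (ha : ‖a‖ = 1) :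
    ∃ h ∈ leftFactor, ∀ q, h q = a * q := by
  obtain ⟨k, -, hk⟩ := exists_mem_rightFactor (r := star a) (by rwa [norm_star])
  have key : ∀ q, (starEquiv * k * starEquiv) q = a * q := fun q => by
    rw [LinearEquiv.mul_apply, LinearEquiv.mul_apply, starEquiv_apply, starEquiv_apply, hk,
      star_mul, star_star, star_star]
  exact ⟨_, ⟨a, ha, key⟩, key⟩

theorem ne_zero_of_norm_eq_one {a : ℍ[ℝ]} (ha : ‖a‖ = 1) : a ≠ 0 :=
  norm_ne_zero_iff.1 (by rw [ha]; exact one_ne_zero)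

/-! ### The common features of lines and oriented lines -/

/-- The common features of the spaces of lines and of oriented lines: `carrier` is the underlying
2-dimensional subspace and `mk` constructs a line from a frame. -/
structure IsLineModel {X : Type} [TopologicalSpace X] [MulAction GL4 X]
    (carrier : X → Submodule ℝ ℍ[ℝ]) (mk : Frame → X) : Prop where
  continuous_smul : ∀ g : GL4, Continuous fun L : X => g • L
  carrier_smul : ∀ (g : GL4) (L : X), carrier (g • L) = (carrier L).map g.toLinearMap
  smul_mk : ∀ (g : GL4) (v : Frame), g • mk v = mk (v.map g)
  mem_carrier_mk : ∀ v : Frame, v.1 0 ∈ carrier (mk v)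
  exists_mem_carrier : ∀ L : X, ∃ q ∈ carrier L, q ≠ 0
  exists_eq_mk : ∀ (L : X) (q : ℍ[ℝ]) (hq : q ≠ 0), q ∈ carrier L →
    ∃ (b : ℍ[ℝ]) (hb : b * b = -1), L = mk (frame q b hq hb)
  mk_mul_of_commute : ∀ (q b c : ℍ[ℝ]) (hq : q ≠ 0) (hb : b * b = -1) (hc : c ≠ 0),
    Commute c b → mk (frame (q * c) b (mul_ne_zero hq hc) hb) = mk (frame q b hq hb)
  -- This is how connectedness of spreads enters. For ordinary lines the conclusion is automatic, as
  -- `(q, q b)` and `(q, -q b)` span the same plane; for oriented lines the hypotheses are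
  -- contradictory.
  eq_mk_of_isPreconnected : ∀ (C : Set X) (b : ℍ[ℝ]) (hb : b * b = -1) (hb' : -b * -b = -1),
    IsPreconnected C →
    (∀ L ∈ C, ∃ (q : ℍ[ℝ]) (hq : q ≠ 0), L = mk (frame q b hq hb) ∨ L = mk (frame q (-b) hq hb')) →
    (∃ (q : ℍ[ℝ]) (hq : q ≠ 0), mk (frame q b hq hb) ∈ C) →
    ∀ (q : ℍ[ℝ]) (hq : q ≠ 0), mk (frame q (-b) hq hb') ∈ C →
      mk (frame q (-b) hq hb') = mk (frame q b hq hb)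

/-- A partition of the line space into connected sets of lines each of which covers every point
exactly once. -/
structure IsConnectedParallelism {X : Type} [TopologicalSpace X]
    (carrier : X → Submodule ℝ ℍ[ℝ]) (P : Set (Set X)) : Prop where
  isPreconnected : ∀ C ∈ P, IsPreconnected C
  existsUnique_line : ∀ C ∈ P, ∀ q : ℍ[ℝ], q ≠ 0 → ∃! L : X, L ∈ C ∧ q ∈ carrier L
  existsUnique_class : ∀ L : X, ∃! C : Set X, C ∈ P ∧ L ∈ C

theorem IsTopologicalParallelism.isConnectedParallelism {X : Type} [TopologicalSpace X]
    {carrier : X → Submodule ℝ ℍ[ℝ]} {Inc : Point → X → Prop}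
    (hInc : ∀ p L, Inc p L ↔ p.submodule ≤ carrier L) {P : Set (Set X)}
    (hP : IsTopologicalParallelism Inc P) : IsConnectedParallelism carrier P where
  isPreconnected C hC := (hP.1 C hC).2.1.isPreconnected
  existsUnique_line C hC q hq := by
    have h := (hP.1 C hC).2.2 (Projectivization.mk ℝ q hq)
    simpa only [hInc, Projectivization.submodule_mk, Submodule.span_singleton_le_iff_mem] using h
  existsUnique_class := hP.2.1

theorem IsConnectedParallelism.eq_of_mem {X : Type} [TopologicalSpace X]
    {carrier : X → Submodule ℝ ℍ[ℝ]} {P : Set (Set X)}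
    (hP : IsConnectedParallelism carrier P) {C D : Set X} (hC : C ∈ P) (hD : D ∈ P)
    {L : X} (hLC : L ∈ C) (hLD : L ∈ D) : C = D :=
  (hP.existsUnique_class L).unique ⟨hC, hLC⟩ ⟨hD, hLD⟩

theorem smul_mem_of_le_aut {X : Type} [MulAction GL4 X] {P : Set (Set X)}
    {H : Subgroup GL4} (hH : H ≤ aut P) {h : GL4} (hh : h ∈ H) {C : Set X} (hC : C ∈ P) : h • C ∈ P := by
  have h1 : h • P = P := hH hh
  rw [← h1]
  exact Set.smul_mem_smul_set hC

/-! ### Classification of parallelisms invariant under a conjugate of the right factor -/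

section Model

variable {X : Type} [TopologicalSpace X] [MulAction GL4 X] {carrier : X → Submodule ℝ ℍ[ℝ]}
  {mk : Frame → X} {P : Set (Set X)}

theorem IsConnectedParallelism.smul (M : IsLineModel carrier mk)
    (hP : IsConnectedParallelism carrier P) (g : GL4) : IsConnectedParallelism carrier (g • P) where
  isPreconnected := by
    rintro _ ⟨C, hC, rfl⟩
    exact (hP.isPreconnected C hC).image _ (M.continuous_smul g).continuousOn
  existsUnique_line := by
    rintro _ ⟨C, hC, rfl⟩ q hq
    obtain ⟨L, ⟨hL, hqL⟩, huniq⟩ := hP.existsUnique_line C hC (g.symm q) (by simpa using hq)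
    refine ⟨g • L, ⟨Set.smul_mem_smul_set hL, ?_⟩, ?_⟩
    · rw [M.carrier_smul]
      exact ⟨g.symm q, hqL, g.apply_symm_apply q⟩
    · rintro _ ⟨⟨L', hL', rfl⟩, hq'⟩
      change q ∈ carrier (g • L') at hq'
      rw [M.carrier_smul] at hq'
      obtain ⟨x, hx, rfl⟩ := hq'
      change g • L' = g • L
      rw [huniq L' ⟨hL', by
        change g.symm (g x) ∈ _
        rwa [g.symm_apply_apply]⟩]
  existsUnique_class := by
    intro L
    obtain ⟨C, ⟨hC, hL⟩, huniq⟩ := hP.existsUnique_class (g⁻¹ • L)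
    refine ⟨g • C, ⟨Set.smul_mem_smul_set hC, Set.mem_smul_set_iff_inv_smul_mem.2 hL⟩, ?_⟩
    rintro _ ⟨⟨D, hD, rfl⟩, hLD⟩
    change g • D = g • C
    rw [huniq D ⟨hD, Set.mem_smul_set_iff_inv_smul_mem.1 hLD⟩]

theorem IsLineModel.exists_frame (M : IsLineModel carrier mk) (L : X) :
    ∃ (q b : ℍ[ℝ]) (hq : q ≠ 0) (hb : b * b = -1), L = mk (frame q b hq hb) := by
  obtain ⟨q, hqL, hq⟩ := M.exists_mem_carrier L
  obtain ⟨b, hb, h⟩ := M.exists_eq_mk L q hq hqL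
  exact ⟨q, b, hq, hb, h⟩

theorem IsLineModel.smul_right (M : IsLineModel carrier mk) {h : GL4} {r q b : ℍ[ℝ]} (hr : r ≠ 0)
    (hh : ∀ x, h x = x * r) (hq : q ≠ 0) (hb : b * b = -1) :
    h • mk (frame q b hq hb) =
      mk (frame (q * r) (r⁻¹ * b * r) (mul_ne_zero hq hr) (conj_mul_self hb hr)) := by
  rw [M.smul_mk, map_frame_right hr hh]

theorem IsLineModel.smul_left (M : IsLineModel carrier mk) {h : GL4} {a q b : ℍ[ℝ]} (ha : a ≠ 0)
    (hh : ∀ x, h x = a * x) (hq : q ≠ 0) (hb : b * b = -1) :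
    h • mk (frame q b hq hb) = mk (frame (a * q) b (mul_ne_zero ha hq) hb) := by
  rw [M.smul_mk, map_frame_left ha hh]

/-- Left multiplication by `x q⁻¹` takes `q` to `x` and keeps `b`; normalizing it introduces only a
real factor, which does not change the line. -/
theorem IsLineModel.mem_orbit_leftFactor_iff (M : IsLineModel carrier mk) {L : X} {q b : ℍ[ℝ]}
    (hq : q ≠ 0) (hb : b * b = -1) :
    L ∈ MulAction.orbit leftFactor (mk (frame q b hq hb)) ↔
      ∃ (x : ℍ[ℝ]) (hx : x ≠ 0), L = mk (frame x b hx hb) := by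
  constructor
  · rintro ⟨⟨h, a, ha, hh⟩, rfl⟩
    exact ⟨_, _, M.smul_left (ne_zero_of_norm_eq_one ha) hh hq hb⟩
  · rintro ⟨x, hx, rfl⟩
    have hxq : x * q⁻¹ ≠ 0 := mul_ne_zero hx (inv_ne_zero hq)
    have ha := exists_normalized hxq
    obtain ⟨h, hh, hhq⟩ := exists_mem_leftFactor ha
    refine ⟨⟨h, hh⟩, ?_⟩
    change h • mk _ = _
    rw [M.smul_left (ne_zero_of_norm_eq_one ha) hhq hq hb]
    have hc : ((‖x * q⁻¹‖⁻¹ : ℝ) : ℍ[ℝ]) ≠ 0 := by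
      rw [← Quaternion.coe_zero]
      exact Quaternion.coe_injective.ne (inv_ne_zero (norm_ne_zero_iff.2 hxq))
    rw [← M.mk_mul_of_commute x b _ hx hb hc (Quaternion.coe_commutes _ b)]
    congr 2
    rw [← Quaternion.coe_commutes, Quaternion.coe_mul_eq_smul, smul_mul_assoc,
      inv_mul_cancel_right₀ hq]

/-- If the stabilizer of a class contains all right multiplications, then the class is an orbit of
the right factor. -/
theorem IsLineModel.eq_orbit_rightFactor (M : IsLineModel carrier mk) {C : Set X}
    (hC : ∀ q : ℍ[ℝ], q ≠ 0 → ∃! L : X, L ∈ C ∧ q ∈ carrier L)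
    (hinv : ∀ h ∈ rightFactor, h • C = C) {L : X} (hL : L ∈ C) :
    C = MulAction.orbit rightFactor L := by
  have hmem : ∀ h ∈ rightFactor, h • L ∈ C := fun h hh => by
    rw [← hinv h hh]; exact Set.smul_mem_smul_set hL
  refine Set.Subset.antisymm (fun N hN => ?_) ?_
  · obtain ⟨x, hxN, hx⟩ := M.exists_mem_carrier N
    obtain ⟨q, b, hq, hb, rfl⟩ := M.exists_frame L
    have hqx : q⁻¹ * x ≠ 0 := mul_ne_zero (inv_ne_zero hq) hx
    have hr := exists_normalized hqx
    obtain ⟨h, hh, hhq⟩ := exists_mem_rightFactor hr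
    -- The right factor is transitive on points: the image of `L` under `h` passes through `x`, as
    -- does `N`, so the two coincide.
    refine ⟨⟨h, hh⟩, (hC x hx).unique ⟨hmem h hh, ?_⟩ ⟨hN, hxN⟩⟩
    change x ∈ carrier (h • mk _)
    rw [M.smul_right (ne_zero_of_norm_eq_one hr) hhq hq hb]
    have h1 := M.mem_carrier_mk (frame (q * ((‖q⁻¹ * x‖⁻¹ : ℝ) • (q⁻¹ * x))) _
      (mul_ne_zero hq (ne_zero_of_norm_eq_one hr))
      (conj_mul_self hb (ne_zero_of_norm_eq_one hr)))
    change q * ((‖q⁻¹ * x‖⁻¹ : ℝ) • (q⁻¹ * x)) ∈ carrier _ at h1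
    have h2 := Submodule.smul_mem _ ‖q⁻¹ * x‖ h1
    have h3 : ‖q⁻¹ * x‖ • (q * ((‖q⁻¹ * x‖⁻¹ : ℝ) • (q⁻¹ * x))) = x := by
      rw [mul_smul_comm, mul_inv_cancel_left₀ hq, smul_smul,
        mul_inv_cancel₀ (norm_ne_zero_iff.2 hqx), one_smul]
    generalize carrier (mk _) = S at h2 ⊢
    rwa [h3] at h2
  · rintro _ ⟨⟨h, hh⟩, rfl⟩
    exact hmem h hh

/-- Every class of a parallelism invariant under the right factor is an orbit of the right or of the
left factor. -/
theorem IsLineModel.class_eq_orbit (M : IsLineModel carrier mk)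
    (hP : IsConnectedParallelism carrier P) (hinv : rightFactor ≤ aut P) {C : Set X} (hC : C ∈ P) :
    ((∀ h ∈ rightFactor, h • C = C) ∧ ∀ L ∈ C, C = MulAction.orbit rightFactor L) ∨
      ∀ L ∈ C, C = MulAction.orbit leftFactor L := by
  -- A right multiplication commuting with `b` fixes the line with frame `(q, q b)`, hence also the
  -- unique class through it.
  have hcent : ∀ (q b : ℍ[ℝ]) (hq : q ≠ 0) (hb : b * b = -1), mk (frame q b hq hb) ∈ C →
      ∀ r : Metric.sphere (0 : ℍ[ℝ]) 1, Commute (r : ℍ[ℝ]) b → rightHom r • C = C := by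
    intro q b hq hb hL r hrb
    have hr : (r : ℍ[ℝ]) ≠ 0 := ne_zero_of_mem_unit_sphere r
    refine hP.eq_of_mem (smul_mem_of_le_aut hinv (rightHom_mem r) hC) hC
      (L := mk (frame q b hq hb)) ?_ hL
    have h1 : rightHom r • mk (frame q b hq hb) = mk (frame q b hq hb) := by
      rw [M.smul_right (inv_ne_zero hr) (rightHom_apply r) hq hb,
        ← M.mk_mul_of_commute q b (r : ℍ[ℝ])⁻¹ hq hb (inv_ne_zero hr) hrb.inv_left₀]
      congr 2
      rw [inv_inv, hrb.eq, mul_inv_cancel_right₀ hr]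
    rw [← h1]
    exact Set.smul_mem_smul_set hL
  -- The dichotomy: either two units occurring in `C` fail to commute, or all of them are `±b`.
  by_cases hex : ∃ (q b q' b' : ℍ[ℝ]) (hq : q ≠ 0) (hb : b * b = -1) (hq' : q' ≠ 0)
      (hb' : b' * b' = -1), mk (frame q b hq hb) ∈ C ∧ mk (frame q' b' hq' hb') ∈ C ∧
      ¬ Commute b b'
  · left
    obtain ⟨q, b, q', b', hq, hb, hq', hb', h1, h2, hbb⟩ := hex
    have htop := eq_top_of_centralizers_le hb hb' hbb
      ((MulAction.stabilizer GL4 C).comap rightHom) (hcent q b hq hb h1) (hcent q' b' hq' hb' h2)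
    have hfix : ∀ h ∈ rightFactor, h • C = C := by
      rintro h ⟨r, hr, hh⟩
      have hmem : (⟨r, by simpa using hr⟩ : Metric.sphere (0 : ℍ[ℝ]) 1)⁻¹ ∈
          (MulAction.stabilizer GL4 C).comap rightHom := by rw [htop]; trivial
      have heq : rightHom (⟨r, by simpa using hr⟩ : Metric.sphere (0 : ℍ[ℝ]) 1)⁻¹ = h :=
        LinearEquiv.ext fun q => by rw [rightHom_apply, hh]; simp
      rw [Subgroup.mem_comap, heq] at hmem
      exact hmem
    exact ⟨hfix, fun L hL => M.eq_orbit_rightFactor (hP.existsUnique_line C hC) hfix hL⟩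
  · right
    intro L hL
    obtain ⟨q, b, hq, hb, rfl⟩ := M.exists_frame L
    have hb' : -b * -b = -1 := by rw [neg_mul_neg, hb]
    have hor : ∀ (x c : ℍ[ℝ]) (hx : x ≠ 0) (hc : c * c = -1), mk (frame x c hx hc) ∈ C →
        c = b ∨ c = -b := by
      intro x c hx hc hmem
      refine eq_or_eq_neg_of_commute hb hc ?_
      by_contra hn
      exact hex ⟨q, b, x, c, hq, hb, hx, hc, hL, hmem, hn⟩
    have key : ∀ (x c : ℍ[ℝ]) (hx : x ≠ 0) (hc : c * c = -1), mk (frame x c hx hc) ∈ C →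
        mk (frame x c hx hc) = mk (frame x b hx hb) := by
      intro x c hx hc hmem
      rcases hor x c hx hc hmem with rfl | rfl
      · rfl
      · refine M.eq_mk_of_isPreconnected C b hb hb' (hP.isPreconnected C hC) ?_ ⟨q, hq, hL⟩ x hx hmem
        intro N hN
        obtain ⟨y, c, hy, hc, rfl⟩ := M.exists_frame N
        rcases hor y c hy hc hN with rfl | rfl
        · exact ⟨y, hy, Or.inl rfl⟩
        · exact ⟨y, hy, Or.inr rfl⟩
    ext N
    rw [M.mem_orbit_leftFactor_iff hq hb]
    constructor
    · intro hN
      obtain ⟨x, c, hx, hc, rfl⟩ := M.exists_frame N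
      exact ⟨x, hx, key x c hx hc hN⟩
    · rintro ⟨x, hx, rfl⟩
      obtain ⟨N, ⟨hN, hxN⟩, -⟩ := hP.existsUnique_line C hC x hx
      obtain ⟨c, hc, rfl⟩ := M.exists_eq_mk N x hx hxN
      rwa [key x c hx hc hN] at hN

/-- Conjugacy of imaginary units lets a right multiplication turn the unit of `L` into that of `N`.
-/
theorem IsLineModel.orbits_inter_nonempty (M : IsLineModel carrier mk) (L N : X) :
    ∃ h ∈ rightFactor, h • L ∈ MulAction.orbit leftFactor N := by
  obtain ⟨q, b, hq, hb, rfl⟩ := M.exists_frame L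
  obtain ⟨x, c, hx, hc, rfl⟩ := M.exists_frame N
  obtain ⟨r, hr, hrc⟩ := exists_conj_eq hb hc
  obtain ⟨h, hh, hhq⟩ := exists_mem_rightFactor hr
  refine ⟨h, hh, ?_⟩
  rw [M.smul_right (ne_zero_of_norm_eq_one hr) hhq hq hb, M.mem_orbit_leftFactor_iff hx hc]
  subst hrc
  exact ⟨_, _, rfl⟩

theorem IsConnectedParallelism.eq_orbits (hP : IsConnectedParallelism carrier P)
    (H : Subgroup GL4) (h : ∀ C ∈ P, ∀ L ∈ C, C = MulAction.orbit H L) :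
    P = Set.range fun L : X => MulAction.orbit H L := by
  ext C
  constructor
  · intro hC
    obtain ⟨L, ⟨hL, -⟩, -⟩ := hP.existsUnique_line C hC 1 one_ne_zero
    exact ⟨L, (h C hC L hL).symm⟩
  · rintro ⟨L, rfl⟩
    obtain ⟨C, ⟨hC, hL⟩, -⟩ := hP.existsUnique_class L
    change MulAction.orbit H L ∈ P
    rwa [← h C hC L hL]

/-- One left orbit among the classes forces all to be left orbits: a class fixed by the right factor
would meet that orbit, hence equal it. -/
theorem IsLineModel.classification (M : IsLineModel carrier mk)
    (hP : IsConnectedParallelism carrier P) (hinv : rightFactor ≤ aut P) :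
    (FixesClasses rightFactor P ∧ P = rightClifford X) ∨
      (TransitiveOnClasses rightFactor P ∧ P = leftClifford X) := by
  by_cases hleft : ∃ C ∈ P, ∀ L ∈ C, C = MulAction.orbit leftFactor L
  · right
    obtain ⟨C, hC, hCorb⟩ := hleft
    obtain ⟨N, ⟨hN, -⟩, -⟩ := hP.existsUnique_line C hC 1 one_ne_zero
    have hall : ∀ D ∈ P, ∀ L ∈ D, D = MulAction.orbit leftFactor L := by
      intro D hD
      rcases M.class_eq_orbit hP hinv hD with ⟨hfix, -⟩ | h
      · obtain ⟨L, ⟨hL, -⟩, -⟩ := hP.existsUnique_line D hD 1 one_ne_zero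
        obtain ⟨h, hh, hhL⟩ := M.orbits_inter_nonempty L N
        rw [← hCorb N hN] at hhL
        have : h • L ∈ D := by rw [← hfix h hh]; exact Set.smul_mem_smul_set hL
        rwa [hP.eq_of_mem hD hC this hhL]
      · exact h
    refine ⟨fun D hD E hE => ?_, hP.eq_orbits leftFactor hall⟩
    obtain ⟨L, ⟨hL, -⟩, -⟩ := hP.existsUnique_line D hD 1 one_ne_zero
    obtain ⟨L', ⟨hL', -⟩, -⟩ := hP.existsUnique_line E hE 1 one_ne_zero
    obtain ⟨h, hh, hhL⟩ := M.orbits_inter_nonempty L L'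
    rw [← hall E hE L' hL'] at hhL
    exact ⟨h, hh, hP.eq_of_mem (smul_mem_of_le_aut hinv hh hD) hE
      (Set.smul_mem_smul_set hL) hhL⟩
  · left
    have hall : ∀ D ∈ P, (∀ h ∈ rightFactor, h • D = D) ∧
        ∀ L ∈ D, D = MulAction.orbit rightFactor L := fun D hD =>
      (M.class_eq_orbit hP hinv hD).resolve_right fun h => hleft ⟨D, hD, h⟩
    exact ⟨fun h hh D hD => (hall D hD).1 h hh,
      hP.eq_orbits rightFactor fun D hD => (hall D hD).2⟩

theorem conj_smul_mem_iff (g h : GL4) (H : Subgroup GL4) :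
    h ∈ MulAut.conj g • H ↔ g⁻¹ * h * g ∈ H := by
  rw [Subgroup.mem_pointwise_smul_iff_inv_smul_mem, ← map_inv, MulAut.smul_def, MulAut.conj_apply,
    inv_inv]

theorem IsLineModel.classification_right (M : IsLineModel carrier mk)
    (hP : IsConnectedParallelism carrier P) (g : GL4) (hinv : MulAut.conj g • rightFactor ≤ aut P) :
    (FixesClasses (MulAut.conj g • rightFactor) P ∧ P = g • rightClifford X) ∨
      (TransitiveOnClasses (MulAut.conj g • rightFactor) P ∧ P = g • leftClifford X) := by
  have hinv' : rightFactor ≤ aut (g⁻¹ • P) := by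
    intro h hh
    have h1 : (g * h * g⁻¹) • P = P := hinv ((conj_smul_mem_iff _ _ _).2 (by
      have : g⁻¹ * (g * h * g⁻¹) * g = h := by group
      rwa [this]))
    change h • g⁻¹ • P = g⁻¹ • P
    rw [eq_inv_smul_iff, smul_smul, smul_smul, h1]
  have mem : ∀ C ∈ P, g⁻¹ • C ∈ g⁻¹ • P := fun C hC => Set.smul_mem_smul_set hC
  rcases M.classification (hP.smul M g⁻¹) hinv' with ⟨hf, he⟩ | ⟨ht, he⟩
  · refine Or.inl ⟨fun h hh C hC => ?_, by rw [← he, smul_inv_smul]⟩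
    have h1 := hf _ ((conj_smul_mem_iff _ _ _).1 hh) _ (mem C hC)
    rwa [smul_smul, mul_inv_cancel_right, mul_smul, smul_left_cancel_iff] at h1
  · refine Or.inr ⟨fun C hC D hD => ?_, by rw [← he, smul_inv_smul]⟩
    obtain ⟨h, hh, hCD⟩ := ht _ (mem C hC) _ (mem D hD)
    refine ⟨g * h * g⁻¹, (conj_smul_mem_iff _ _ _).2 (by
      have : g⁻¹ * (g * h * g⁻¹) * g = h := by group
      rwa [this]), ?_⟩
    rw [eq_inv_smul_iff, smul_smul, smul_smul] at hCD
    exact hCD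

end Model

/-! ### Exchange of the two factors by quaternion conjugation -/

theorem star_mul_star_mem_rightFactor_iff (h : GL4) :
    starEquiv * h * starEquiv ∈ rightFactor ↔ h ∈ leftFactor := by
  constructor
  · rintro ⟨b, hb, hh⟩
    refine ⟨star b, by rwa [norm_star], fun q => ?_⟩
    have := hh (star q)
    rw [LinearEquiv.mul_apply, LinearEquiv.mul_apply, starEquiv_apply, starEquiv_apply,
      star_star] at this
    rw [← star_star (h q), this, star_mul, star_star]
  · rintro ⟨a, ha, hh⟩
    refine ⟨star a, by rwa [norm_star], fun q => ?_⟩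
    rw [LinearEquiv.mul_apply, LinearEquiv.mul_apply, starEquiv_apply, starEquiv_apply, hh,
      star_mul, star_star]

theorem conj_starEquiv_smul_rightFactor : MulAut.conj starEquiv • rightFactor = leftFactor := by
  ext h
  rw [conj_smul_mem_iff, starEquiv_inv, star_mul_star_mem_rightFactor_iff]

theorem smul_range_orbit {X : Type} [MulAction GL4 X] (g : GL4) (H : Subgroup GL4) :
    g • (Set.range fun L : X => MulAction.orbit H L) =
      Set.range fun L : X => MulAction.orbit (MulAut.conj g • H : Subgroup GL4) L := by
  have key : ∀ L : X, g • MulAction.orbit H L =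
      MulAction.orbit (MulAut.conj g • H : Subgroup GL4) (g • L) := by
    intro L
    ext N
    rw [Set.mem_smul_set_iff_inv_smul_mem]
    constructor
    · rintro ⟨⟨h, hh⟩, e⟩
      refine ⟨⟨g * h * g⁻¹, (conj_smul_mem_iff _ _ _).2 ?_⟩, ?_⟩
      · have : g⁻¹ * (g * h * g⁻¹) * g = h := by group
        rwa [this]
      · change h • L = g⁻¹ • N at e
        change (g * h * g⁻¹) • g • L = N
        rw [smul_smul, inv_mul_cancel_right, mul_smul, e, smul_inv_smul]
    · rintro ⟨⟨h, hh⟩, e⟩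
      refine ⟨⟨g⁻¹ * h * g, (conj_smul_mem_iff _ _ _).1 hh⟩, ?_⟩
      change h • g • L = N at e
      change (g⁻¹ * h * g) • L = g⁻¹ • N
      rw [← e, smul_smul, smul_smul, mul_assoc]
  ext C
  constructor
  · rintro ⟨_, ⟨L, rfl⟩, rfl⟩
    exact ⟨g • L, (key L).symm⟩
  · rintro ⟨L, rfl⟩
    refine ⟨_, ⟨g⁻¹ • L, rfl⟩, ?_⟩
    change g • MulAction.orbit H (g⁻¹ • L) = _
    rw [key, smul_inv_smul]

theorem starEquiv_smul_rightClifford (X : Type) [MulAction GL4 X] :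
    starEquiv • rightClifford X = leftClifford X := by
  rw [rightClifford, smul_range_orbit, conj_starEquiv_smul_rightFactor, leftClifford]

theorem starEquiv_smul_leftClifford (X : Type) [MulAction GL4 X] :
    starEquiv • leftClifford X = rightClifford X := by
  rw [← starEquiv_smul_rightClifford, ← eq_inv_smul_iff, starEquiv_inv]

/-- This is the right-hand case for `g * starEquiv`. -/
theorem IsLineModel.classification_left {X : Type} [TopologicalSpace X] [MulAction GL4 X]
    {carrier : X → Submodule ℝ ℍ[ℝ]} {mk : Frame → X} {P : Set (Set X)}
    (M : IsLineModel carrier mk)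
    (hP : IsConnectedParallelism carrier P) (g : GL4) (hinv : MulAut.conj g • leftFactor ≤ aut P) :
    (FixesClasses (MulAut.conj g • leftFactor) P ∧ P = g • leftClifford X) ∨
      (TransitiveOnClasses (MulAut.conj g • leftFactor) P ∧ P = g • rightClifford X) := by
  have h := M.classification_right hP (g * starEquiv)
  simp only [map_mul, mul_smul, conj_starEquiv_smul_rightFactor, starEquiv_smul_rightClifford,
    starEquiv_smul_leftClifford] at h
  exact h hinv
/-! ### Lines and oriented lines from frames -/

theorem Line.smul_ofFrame (g : GL4) (v : Frame) : g • Line.ofFrame v = Line.ofFrame (v.map g) := by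
  apply Subtype.ext
  change (Submodule.span ℝ (Set.range v.1)).map g.toLinearMap =
    Submodule.span ℝ (Set.range (g ∘ v.1))
  rw [Submodule.map_span, Set.range_comp]
  rfl

theorem Frame.continuous_map (g : GL4) : Continuous (Frame.map g) := by
  refine Continuous.subtype_mk (continuous_pi fun i => ?_) _
  exact (g.toLinearMap.continuous_of_finiteDimensional).comp
    ((continuous_apply i).comp continuous_subtype_val)

theorem Line.continuous_ofFrame : Continuous Line.ofFrame := continuous_coinduced_rng

theorem OrientedLine.continuous_ofFrame : Continuous OrientedLine.ofFrame :=
  continuous_coinduced_rng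

/-- Orientations of equal but not syntactically identical subspaces have different types; a basis of
`A` with the vectors of `v` permits substituting one subspace for the other. -/
theorem OrientedLine.ofFrame_eq_mk {A : Submodule ℝ ℍ[ℝ]} (hA : Module.finrank ℝ A = 2) (v : Frame)
    (e : Module.Basis (Fin 2) ℝ A) (hv : ∀ i, (e i : ℍ[ℝ]) = v.1 i) :
    OrientedLine.ofFrame v = ⟨⟨A, hA⟩, e.orientation⟩ := by
  obtain rfl : A = Submodule.span ℝ (Set.range v.1) := by
    have : Set.range v.1 = A.subtype '' Set.range e := by
      rw [← Set.range_comp]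
      congr 1
      funext i
      exact (hv i).symm
    rw [this, ← Submodule.map_span, e.span_eq, Submodule.map_top, Submodule.range_subtype]
  obtain rfl : e = Module.Basis.span v.2 := Module.Basis.eq_of_apply_eq fun i => Subtype.ext (by
    rw [hv i, Module.Basis.span_apply])
  rfl

/-- An oriented line is given by a frame whose members form a positively oriented basis. -/
theorem OrientedLine.eq_ofFrame {L : OrientedLine} {v : Frame}
    (e : Module.Basis (Fin 2) ℝ L.line.1) (he : e.orientation = L.orientation)
    (hv : ∀ i, (e i : ℍ[ℝ]) = v.1 i) : OrientedLine.ofFrame v = L := by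
  rw [OrientedLine.ofFrame_eq_mk L.line.2 v e hv, he]
  rfl

theorem Line.coe_span_ofFrame (v : Frame) (i : Fin 2) :
    ((Module.Basis.span v.2 : Module.Basis (Fin 2) ℝ (Line.ofFrame v).1) i : ℍ[ℝ]) = v.1 i :=
  congrArg Subtype.val (Module.Basis.span_apply v.2 i)

theorem OrientedLine.smul_ofFrame (g : GL4) (v : Frame) :
    g • OrientedLine.ofFrame v = OrientedLine.ofFrame (v.map g) := by
  symm
  refine OrientedLine.eq_ofFrame
    ((Module.Basis.span v.2).map (g.submoduleMap (Line.ofFrame v).1)) ?_ fun i => ?_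
  · exact Module.Basis.orientation_map _ _
  · exact congrArg g (Line.coe_span_ofFrame v i)

/-- Two bases are equally oriented if the transition determinant is positive. -/
theorem orientation_eq_of_eq_add {M : Type*} [AddCommGroup M] [Module ℝ M]
    (e f : Module.Basis (Fin 2) ℝ M) {s t s' t' : ℝ} (h0 : f 0 = s • e 0 + t • e 1)
    (h1 : f 1 = s' • e 0 + t' • e 1) (hdet : 0 < s * t' - t * s') :
    e.orientation = f.orientation := by
  rw [Module.Basis.orientation_eq_iff_det_pos, Module.Basis.det_apply, Matrix.det_fin_two]
  simp only [Module.Basis.toMatrix_apply, h0, h1]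
  simp
  linarith

theorem OrientedLine.ofFrame_eq_of_eq_add (v w : Frame) {s t s' t' : ℝ}
    (h0 : w.1 0 = s • v.1 0 + t • v.1 1) (h1 : w.1 1 = s' • v.1 0 + t' • v.1 1)
    (hdet : 0 < s * t' - t * s') : OrientedLine.ofFrame w = OrientedLine.ofFrame v := by
  have hmem : ∀ i, w.1 i ∈ Submodule.span ℝ (Set.range v.1) := by
    have hv : ∀ i, v.1 i ∈ Submodule.span ℝ (Set.range v.1) := fun i =>
      Submodule.subset_span ⟨i, rfl⟩
    intro i
    fin_cases i
    · exact h0 ▸ add_mem (Submodule.smul_mem _ _ (hv 0)) (Submodule.smul_mem _ _ (hv 1))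
    · exact h1 ▸ add_mem (Submodule.smul_mem _ _ (hv 0)) (Submodule.smul_mem _ _ (hv 1))
  let w' : Fin 2 → (Line.ofFrame v).1 := fun i => ⟨w.1 i, hmem i⟩
  have hw' : LinearIndependent ℝ w' :=
    LinearIndependent.of_comp (Line.ofFrame v).1.subtype w.2
  let f := basisOfLinearIndependentOfCardEqFinrank hw'
    (by rw [(Line.ofFrame v).2, Fintype.card_fin])
  have hf : ∀ i, (f i : ℍ[ℝ]) = w.1 i := fun i =>
    congrArg Subtype.val (congrFun (coe_basisOfLinearIndependentOfCardEqFinrank hw' _) i)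
  let e : Module.Basis (Fin 2) ℝ (Line.ofFrame v).1 := Module.Basis.span v.2
  have he : ∀ i, (e i : ℍ[ℝ]) = v.1 i := Line.coe_span_ofFrame v
  refine OrientedLine.eq_ofFrame f (orientation_eq_of_eq_add e f ?_ ?_ hdet).symm hf
  · refine Subtype.ext ((hf 0).trans ?_)
    rw [h0, ← he, ← he]
    rfl
  · refine Subtype.ext ((hf 1).trans ?_)
    rw [h1, ← he, ← he]
    rfl

theorem OrientedLine.exists_ofFrame_eq (L : OrientedLine) {q : ℍ[ℝ]} (hq : q ≠ 0)
    (hqL : q ∈ L.line.1) : ∃ v : Frame, v.1 0 = q ∧ OrientedLine.ofFrame v = L := by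
  obtain ⟨w, hw⟩ := exists_linearIndependent_pair_of_one_lt_finrank
    (by rw [L.line.2]; norm_num) (x := (⟨q, hqL⟩ : L.line.1)) (by simpa using hq)
  let e := basisOfLinearIndependentOfCardEqFinrank hw (by rw [L.line.2, Fintype.card_fin])
  have he : ⇑e = ![⟨q, hqL⟩, w] := coe_basisOfLinearIndependentOfCardEqFinrank hw _
  have key : ∀ f : Module.Basis (Fin 2) ℝ L.line.1, f.orientation = L.orientation →
      f 0 = ⟨q, hqL⟩ → ∃ v : Frame, v.1 0 = q ∧ OrientedLine.ofFrame v = L := by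
    intro f hf hf0
    refine ⟨⟨fun i => (f i : ℍ[ℝ]), ?_⟩, by simp [hf0], OrientedLine.eq_ofFrame f hf fun i => rfl⟩
    exact f.linearIndependent.map' L.line.1.subtype (Submodule.ker_subtype _)
  rcases e.orientation_eq_or_eq_neg L.orientation with h | h
  · exact key e h.symm (by rw [he]; rfl)
  -- Negating the second basis vector reverses the orientation and keeps `q` in first place.
  · refine key (e.unitsSMul (Function.update 1 1 (-1))) ?_ ?_
    · rw [Module.Basis.orientation_neg_single, h]
    · rw [Module.Basis.unitsSMul_apply, he]; simp

theorem frame_coord_ne_zero (v : Frame) (i : Fin 2) : v.1 i ≠ 0 := v.2.ne_zero i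

/-- By independence `v₀⁻¹ v₁` is not real, so it is `s + t b` with `t > 0`. The transition
determinant from `(v₀, v₀ b)` to `v` is `t`. -/
theorem ofFrame_eq_frame (v : Frame) :
    ∃ (b : ℍ[ℝ]) (hb : b * b = -1), OrientedLine.ofFrame v =
      OrientedLine.ofFrame (frame (v.1 0) b (frame_coord_ne_zero v 0) hb) := by
  have h0 := frame_coord_ne_zero v 0
  have hx : ∀ s : ℝ, (v.1 0)⁻¹ * v.1 1 ≠ s := by
    intro s hs
    rw [inv_mul_eq_iff_eq_mul₀ h0, ← Quaternion.coe_commutes, Quaternion.coe_mul_eq_smul] at hs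
    have hli := v.2
    have h2 : v.1 = ![v.1 0, v.1 1] := by
      funext i; fin_cases i <;> rfl
    rw [h2, LinearIndependent.pair_iff] at hli
    have := (hli (-s) 1 (by rw [hs]; simp)).2
    exact one_ne_zero this
  obtain ⟨b, hb, s, t, ht, h⟩ := exists_eq_add_imaginaryUnit hx
  refine ⟨b, hb, OrientedLine.ofFrame_eq_of_eq_add (frame (v.1 0) b h0 hb) v
    (s := 1) (t := 0) (s' := s) (t' := t) ?_ ?_ (by simpa using ht)⟩
  · change v.1 0 = (1 : ℝ) • v.1 0 + (0 : ℝ) • (v.1 0 * b)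
    simp
  · change v.1 1 = s • v.1 0 + t • (v.1 0 * b)
    rw [inv_mul_eq_iff_eq_mul₀ h0] at h
    rw [h, mul_add, mul_smul_comm, mul_smul_comm, mul_one]

theorem OrientedLine.exists_eq_ofFrame (L : OrientedLine) (q : ℍ[ℝ]) (hq : q ≠ 0)
    (hqL : q ∈ L.line.1) :
    ∃ (b : ℍ[ℝ]) (hb : b * b = -1), L = OrientedLine.ofFrame (frame q b hq hb) := by
  obtain ⟨v, rfl, rfl⟩ := L.exists_ofFrame_eq hq hqL
  exact ofFrame_eq_frame v

/-- Here `c = s + t b`, so the change of frame has determinant `s² + t² > 0`. -/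
theorem OrientedLine.ofFrame_mul_of_commute (q b c : ℍ[ℝ]) (hq : q ≠ 0) (hb : b * b = -1)
    (hc : c ≠ 0) (h : Commute c b) :
    OrientedLine.ofFrame (frame (q * c) b (mul_ne_zero hq hc) hb) =
      OrientedLine.ofFrame (frame q b hq hb) := by
  obtain ⟨s, t, rfl⟩ := exists_eq_add_of_commute hb h
  refine OrientedLine.ofFrame_eq_of_eq_add _ _ (s := s) (t := t) (s' := -t) (t' := s) ?_ ?_ ?_
  · change q * (s • (1 : ℍ[ℝ]) + t • b) = s • q + t • (q * b)
    rw [mul_add, mul_smul_comm, mul_smul_comm, mul_one]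
  · change q * (s • (1 : ℍ[ℝ]) + t • b) * b = (-t) • q + s • (q * b)
    rw [mul_assoc, add_mul, smul_mul_assoc, smul_mul_assoc, hb, mul_add, mul_smul_comm,
      mul_smul_comm, mul_neg, mul_one, one_mul, smul_neg, neg_smul, add_comm]
  · have : s ≠ 0 ∨ t ≠ 0 := by
      by_contra hst
      push Not at hst
      exact hc (by simp [hst.1, hst.2])
    rcases this with h | h
    · nlinarith [mul_self_pos.2 h, mul_self_nonneg t]
    · nlinarith [mul_self_pos.2 h, mul_self_nonneg s]

/-! ### Sign of an alternating form on oriented lines -/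

/-- The alternating form `(x, y) ↦ ⟨x b, y⟩` attached to an imaginary quaternion `b`. -/
def imForm (b x y : ℍ[ℝ]) : ℝ := (star (x * b) * y).re

theorem imForm_self {b : ℍ[ℝ]} (hb : b.re = 0) (x : ℍ[ℝ]) : imForm b x x = 0 := by
  simp [imForm, hb]; ring

theorem imForm_swap {b : ℍ[ℝ]} (hb : b.re = 0) (x y : ℍ[ℝ]) : imForm b y x = -imForm b x y := by
  simp [imForm, hb]; ring

/-- An alternating form on a plane scales by the determinant, so its sign depends only on the
orientation. -/
theorem imForm_add_smul {b : ℍ[ℝ]} (hb : b.re = 0) (x y : ℍ[ℝ]) (s t s' t' : ℝ) :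
    imForm b (s • x + t • y) (s' • x + t' • y) = (s * t' - t * s') * imForm b x y := by
  have : imForm b (s • x + t • y) (s' • x + t' • y) = s * s' * imForm b x x +
      s * t' * imForm b x y + t * s' * imForm b y x + t * t' * imForm b y y := by
    simp only [imForm, add_mul, smul_mul_assoc, star_add, Quaternion.star_smul, mul_add,
      mul_smul_comm, Quaternion.re_add, Quaternion.re_smul, smul_eq_mul]
    ring
  rw [this, imForm_self hb, imForm_self hb, imForm_swap hb x y]
  ring

/-- Positivity of `imForm b` does not depend on the positively oriented frame. -/
theorem imForm_pos_of_orientation_eq {b : ℍ[ℝ]} (hb : b.re = 0) {A : Submodule ℝ ℍ[ℝ]}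
    (e f : Module.Basis (Fin 2) ℝ A) (h : e.orientation = f.orientation)
    (hpos : 0 < imForm b (e 0) (e 1)) : 0 < imForm b (f 0) (f 1) := by
  rw [Module.Basis.orientation_eq_iff_det_pos, Module.Basis.det_apply, Matrix.det_fin_two] at h
  simp only [Module.Basis.toMatrix_apply] at h
  have hf : ∀ i, (f i : ℍ[ℝ]) = e.repr (f i) 0 • (e 0 : ℍ[ℝ]) + e.repr (f i) 1 • (e 1 : ℍ[ℝ]) := by
    intro i
    have := congrArg (Subtype.val) (e.sum_repr (f i))
    rw [Fin.sum_univ_two] at this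
    exact this.symm
  rw [hf 0, hf 1, imForm_add_smul hb]
  exact mul_pos (by linarith) hpos

/-- The oriented lines on which `imForm b` is positive. -/
def OrientedLine.positive (b : ℍ[ℝ]) : Set OrientedLine :=
  {L | ∃ e : Module.Basis (Fin 2) ℝ L.line.1, e.orientation = L.orientation ∧
    0 < imForm b (e 0) (e 1)}

theorem OrientedLine.ofFrame_mem_positive_iff {b : ℍ[ℝ]} (hb : b.re = 0) (v : Frame) :
    OrientedLine.ofFrame v ∈ OrientedLine.positive b ↔ 0 < imForm b (v.1 0) (v.1 1) := by
  rw [← Line.coe_span_ofFrame v 0, ← Line.coe_span_ofFrame v 1]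
  constructor
  · rintro ⟨e, he, hpos⟩
    exact imForm_pos_of_orientation_eq hb e (Module.Basis.span v.2) he hpos
  · exact fun h => ⟨Module.Basis.span v.2, rfl, h⟩

theorem OrientedLine.isOpen_positive {b : ℍ[ℝ]} (hb : b.re = 0) :
    IsOpen (OrientedLine.positive b) := by
  rw [isOpen_coinduced]
  have : OrientedLine.ofFrame ⁻¹' OrientedLine.positive b =
      {v : Frame | 0 < imForm b (v.1 0) (v.1 1)} := by
    ext v
    exact OrientedLine.ofFrame_mem_positive_iff hb v
  rw [this]
  refine isOpen_lt continuous_const ?_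
  have h0 : Continuous fun v : Frame => v.1 0 := (continuous_apply 0).comp continuous_subtype_val
  have h1 : Continuous fun v : Frame => v.1 1 := (continuous_apply 1).comp continuous_subtype_val
  exact Quaternion.continuous_re.comp ((h0.mul continuous_const).star.mul h1)

theorem imForm_frame {b : ℍ[ℝ]} (hb : b * b = -1) {q : ℍ[ℝ]} (hq : q ≠ 0) :
    0 < imForm b q (q * b) := by
  rw [imForm, Quaternion.star_mul_self, Quaternion.re_coe, Quaternion.normSq_eq_norm_mul_self]
  exact mul_self_pos.2 (norm_ne_zero_iff.2 (mul_ne_zero hq (ne_zero_of_mul_self hb)))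

theorem imForm_neg_left (b x y : ℍ[ℝ]) : imForm (-b) x y = -imForm b x y := by
  simp only [imForm, mul_neg, star_neg, neg_mul, Quaternion.re_neg]
/-! ### The two line spaces are instances -/

theorem Line.exists_mem_ne_zero (L : Line) : ∃ q ∈ L.1, q ≠ 0 := by
  refine Submodule.exists_mem_ne_zero_of_ne_bot fun h => ?_
  have h2 := L.2
  rw [h, finrank_bot] at h2
  exact absurd h2 (by norm_num)

theorem isLineModel_orientedLine :
    IsLineModel (fun L : OrientedLine => L.line.1) OrientedLine.ofFrame where
  continuous_smul g := by
    rw [continuous_coinduced_dom]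
    have : (fun L : OrientedLine => g • L) ∘ OrientedLine.ofFrame =
        OrientedLine.ofFrame ∘ Frame.map g := funext fun v => OrientedLine.smul_ofFrame g v
    rw [this]
    exact OrientedLine.continuous_ofFrame.comp (Frame.continuous_map g)
  carrier_smul _ _ := rfl
  smul_mk := OrientedLine.smul_ofFrame
  mem_carrier_mk v := Submodule.subset_span ⟨0, rfl⟩
  exists_mem_carrier L := L.line.exists_mem_ne_zero
  exists_eq_mk := OrientedLine.exists_eq_ofFrame
  mk_mul_of_commute := OrientedLine.ofFrame_mul_of_commute
  eq_mk_of_isPreconnected C b hb hb' hC := by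
    rintro hcov ⟨x, hx, hxC⟩ q hq hqC
    have hre := re_eq_zero_of_mul_self hb
    have hre' := re_eq_zero_of_mul_self hb'
    -- The open sets where the forms of `b` and `-b` are positive cover `C` and both meet it.
    -- Preconnectedness gives a common line, although the two forms are negatives of each other.
    obtain ⟨L, -, h1, h2⟩ := hC _ _ (OrientedLine.isOpen_positive hre)
      (OrientedLine.isOpen_positive hre') (fun L hL => by
        obtain ⟨y, hy, rfl | rfl⟩ := hcov L hL
        · exact Or.inl ((OrientedLine.ofFrame_mem_positive_iff hre _).2 (imForm_frame hb hy))
        · exact Or.inr ((OrientedLine.ofFrame_mem_positive_iff hre' _).2 (imForm_frame hb' hy)))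
      ⟨_, hxC, (OrientedLine.ofFrame_mem_positive_iff hre _).2 (imForm_frame hb hx)⟩
      ⟨_, hqC, (OrientedLine.ofFrame_mem_positive_iff hre' _).2 (imForm_frame hb' hq)⟩
    obtain ⟨x, hxL, hx⟩ := L.line.exists_mem_ne_zero
    obtain ⟨c, hc, rfl⟩ := L.exists_eq_ofFrame x hx hxL
    rw [OrientedLine.ofFrame_mem_positive_iff hre] at h1
    rw [OrientedLine.ofFrame_mem_positive_iff hre', imForm_neg_left] at h2
    linarith

theorem Line.ofFrame_neg (q b : ℍ[ℝ]) (hq : q ≠ 0) (hb : b * b = -1) (hb' : -b * -b = -1) :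
    Line.ofFrame (frame q (-b) hq hb') = Line.ofFrame (frame q b hq hb) := by
  have hle : (Line.ofFrame (frame q (-b) hq hb')).1 ≤ (Line.ofFrame (frame q b hq hb)).1 := by
    refine Submodule.span_le.2 ?_
    rintro _ ⟨i, rfl⟩
    fin_cases i
    · exact Submodule.subset_span ⟨0, rfl⟩
    · change q * -b ∈ _
      rw [mul_neg]
      exact neg_mem (Submodule.subset_span ⟨1, rfl⟩)
  refine Subtype.ext (Submodule.eq_of_le_of_finrank_eq hle ?_)
  rw [(Line.ofFrame _).2, (Line.ofFrame _).2]

theorem Line.exists_orientedLine (L : Line) : ∃ L' : OrientedLine, L'.line = L :=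
  ⟨⟨L, (Module.finBasisOfFinrankEq ℝ L.1 L.2).orientation⟩, rfl⟩

theorem isLineModel_line : IsLineModel (fun L : Line => L.1) Line.ofFrame where
  continuous_smul g := by
    rw [continuous_coinduced_dom]
    have : (fun L : Line => g • L) ∘ Line.ofFrame = Line.ofFrame ∘ Frame.map g :=
      funext fun v => Line.smul_ofFrame g v
    rw [this]
    exact Line.continuous_ofFrame.comp (Frame.continuous_map g)
  carrier_smul _ _ := rfl
  smul_mk := Line.smul_ofFrame
  mem_carrier_mk v := Submodule.subset_span ⟨0, rfl⟩
  exists_mem_carrier := Line.exists_mem_ne_zero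
  exists_eq_mk L q hq hqL := by
    -- Any orientation will do: the oriented statement is used and the orientation then forgotten.
    obtain ⟨L', rfl⟩ := L.exists_orientedLine
    obtain ⟨b, hb, h⟩ := L'.exists_eq_ofFrame q hq hqL
    exact ⟨b, hb, congrArg OrientedLine.line h⟩
  mk_mul_of_commute q b c hq hb hc h :=
    congrArg OrientedLine.line (OrientedLine.ofFrame_mul_of_commute q b c hq hb hc h)
  eq_mk_of_isPreconnected _ b hb hb' _ _ _ q hq _ := Line.ofFrame_neg q b hq hb hb'

end RealParallelism

end

theorem mainTheorem2 (g : GL4) :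
    (∀ P : Set (Set Line), IsOrdinaryParallelism P →
      (MulAut.conj g • rightFactor ≤ aut P →
        (FixesClasses (MulAut.conj g • rightFactor) P ∧
            P = g • rightClifford Line) ∨
        (TransitiveOnClasses (MulAut.conj g • rightFactor) P ∧
            P = g • leftClifford Line)) ∧
      (MulAut.conj g • leftFactor ≤ aut P →
        (FixesClasses (MulAut.conj g • leftFactor) P ∧
            P = g • leftClifford Line) ∨
        (TransitiveOnClasses (MulAut.conj g • leftFactor) P ∧
            P = g • rightClifford Line))) ∧
    (∀ P : Set (Set OrientedLine), IsOrientedParallelism P →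
      (MulAut.conj g • rightFactor ≤ aut P →
        (FixesClasses (MulAut.conj g • rightFactor) P ∧
            P = g • rightClifford OrientedLine) ∨
        (TransitiveOnClasses (MulAut.conj g • rightFactor) P ∧
            P = g • leftClifford OrientedLine)) ∧
      (MulAut.conj g • leftFactor ≤ aut P →
        (FixesClasses (MulAut.conj g • leftFactor) P ∧
            P = g • leftClifford OrientedLine) ∨
        (TransitiveOnClasses (MulAut.conj g • leftFactor) P ∧
            P = g • rightClifford OrientedLine))) := by
  refine ⟨fun P hP => ?_, fun P hP => ?_⟩
  · have h := hP.isConnectedParallelism (carrier := fun L : Line => L.1) fun _ _ => Iff.rfl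
    exact ⟨isLineModel_line.classification_right h g, isLineModel_line.classification_left h g⟩
  · have h := hP.isConnectedParallelism (carrier := fun L : OrientedLine => L.line.1)
      fun _ _ => Iff.rfl
    exact ⟨isLineModel_orientedLine.classification_right h g,
      isLineModel_orientedLine.classification_left h g⟩
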